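/- Let $\mathbb{K}=\mathbb{R}$ or $\mathbb{C}$; all Banach spaces are over $\mathbb{K}$. Let $(r_j)_{j\ge 1}$ be the Rademacher functions, $r_j(t)=\operatorname{sign}(\sin(2^j\pi t))$ on $[0,1]$. For a Banach space $E$ let $\mathrm{Rad}(E)$ be the Banach space of almost unconditionally summable sequences in $E$, that is, of all sequences $(x_j)_{j\ge1}$ in $E$ for which $\sum_j r_jx_j$ converges in $L_2([0,1];E)$, with the norm $\|(x_j)_j\|_{\mathrm{Rad}}=\big\|\sum_{j} r_jx_j\big\|_{L_2([0,1];E)}$. A scalar sequence space is a Banach space $\lambda\subseteq\mathbb{K}^{\mathbb{N}}$ (with coordinatewise operations) such that $c_{00}\subseteq\lambda\subseteq\ell_\infty$, $\|\cdot\|_\infty\le\|\cdot\|_\lambda$ on $\lambda$, the unit vectors $(e_j)_{j\ge1}$ form a Schauder basis of $\lambda$, and $\|e_j\|_\lambda=1$ for every $j$. A Banach operator ideal $\mathcal{I}$ assigns to each pair $(E,F)$ of Banach spaces a linear subspace $\mathcal{I}(E,F)$ of the space $\mathcal{L}(E,F)$ of bounded linear operators, which is a Banach space under a norm $\|\cdot\|_{\mathcal{I}}$,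 so that $\mathrm{id}_{\mathbb{K}}\in\mathcal{I}(\mathbb{K},\mathbb{K})$ with $\|\mathrm{id}_{\mathbb{K}}\|_{\mathcal{I}}=1$, and, whenever $u\in\mathcal{L}(E,F)$, $v\in\mathcal{I}(F,G)$ and $w\in\mathcal{L}(G,H)$, one has $w\circ v\circ u\in\mathcal{I}(E,H)$ and $\|w\circ v\circ u\|_{\mathcal{I}}\le\|w\|\,\|v\|_{\mathcal{I}}\,\|u\|$. A sequence class is a rule $X$ that assigns to each Banach space $E$ a Banach space $X(E)$ of $E$-valued sequences with $c_{00}(E)\subseteq X(E)\subseteq\ell_\infty(E)$, $\|\cdot\|_\infty\le\|\cdot\|_{X(E)}$ on $X(E)$, and $\|e_j\|_{X(\mathbb{K})}=1$ for every $j$; the rule $\mathrm{Rad}$ is one. A sequence class $X$ is ideal-representable if there are a Banach operator ideal $\mathcal{I}$ and a scalar sequence space $\lambda$ such that, for every Banach space $E$, the map $\mathcal{I}(\lambda,E)\to X(E)$, $u\mapsto(u(e_j))_{j\ge1}$, is a well-defined isometric isomorphism onto $X(E)$. **Corollary.** The sequence class $\mathrm{Rad}$ is not ideal-representable. -/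

import Mathlib

open Filter Topology MeasureTheory

universe u

noncomputable section

/-- A Banach space whose underlying vector space is a linear subspace of the vector space `V`,
normed by a norm of its own. -/
structure BanachSubspace (𝕜 : Type*) [RCLike 𝕜] (V : Type*) [AddCommGroup V] [Module 𝕜 V] where
  carrier : Submodule 𝕜 V
  nrm : Seminorm 𝕜 carrier
  eq_zero_of_nrm : ∀ x : carrier, nrm x = 0 → x = 0
  complete : ∀ s : ℕ → carrier,
    (∀ ε : ℝ, 0 < ε → ∃ N : ℕ, ∀ m ≥ N, ∀ n ≥ N, nrm (s m - s n) < ε) →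
      ∃ x : carrier, Tendsto (fun n => nrm (s n - x)) atTop (𝓝 0)

namespace BanachSubspace

variable {𝕜 : Type*} [RCLike 𝕜] {V : Type*} [AddCommGroup V] [Module 𝕜 V]

/-- The Banach space itself, as a type of its own: a type synonym of the carrier, so that its
topology is that of its norm and not one inherited from `V`. -/
def Space (B : BanachSubspace 𝕜 V) : Type _ := B.carrier

variable (B : BanachSubspace 𝕜 V)

instance : AddCommGroup B.Space := inferInstanceAs (AddCommGroup B.carrier)

instance : Module 𝕜 B.Space := inferInstanceAs (Module 𝕜 B.carrier)

instance : Norm B.Space := ⟨fun x => B.nrm x⟩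

theorem core : NormedSpace.Core 𝕜 B.Space where
  norm_nonneg x := apply_nonneg B.nrm x
  norm_smul c x := map_smul_eq_mul B.nrm c x
  norm_triangle x y := map_add_le_add B.nrm x y
  norm_eq_zero_iff x := ⟨B.eq_zero_of_nrm x, fun h => by
    rw [h]; exact map_zero B.nrm⟩

instance : NormedAddCommGroup B.Space := NormedAddCommGroup.ofCore B.core

instance : NormedSpace 𝕜 B.Space := NormedSpace.ofCore B.core

instance : CompleteSpace B.Space := by
  refine Metric.complete_of_cauchySeq_tendsto fun s hs => ?_
  rw [Metric.cauchySeq_iff] at hs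
  obtain ⟨x, hx⟩ := B.complete s fun ε hε => by
    obtain ⟨N, hN⟩ := hs ε hε
    refine ⟨N, fun m hm n hn => ?_⟩
    have := hN m hm n hn
    rw [dist_eq_norm] at this
    exact this
  exact ⟨x, tendsto_iff_norm_sub_tendsto_zero.2 hx⟩

/-- The inclusion of the Banach space into the ambient vector space. -/
def incl : B.Space →ₗ[𝕜] V := B.carrier.subtype

end BanachSubspace

/-- A sequence class over `𝕜`: to each Banach space `E` it assigns a Banach space `X(E)` of
`E`-valued sequences with `c₀₀(E) ⊆ X(E)`, with `X(E)` contained in `ℓ_∞(E)` and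
`‖x‖_∞ ≤ ‖x‖_{X(E)}`, and with `‖e_j‖_{X(𝕜)} = 1`. Sequences are indexed from `0`. -/
structure SequenceClass (𝕜 : Type u) [RCLike 𝕜] where
  obj : ∀ (E : Type u) [NormedAddCommGroup E] [NormedSpace 𝕜 E] [CompleteSpace E],
    BanachSubspace 𝕜 (ℕ → E)
  finite_mem : ∀ (E : Type u) [NormedAddCommGroup E] [NormedSpace 𝕜 E] [CompleteSpace E]
    (x : ℕ → E), (Function.support x).Finite → x ∈ (obj E).carrier
  norm_le : ∀ (E : Type u) [NormedAddCommGroup E] [NormedSpace 𝕜 E] [CompleteSpace E]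
    (x : (obj E).carrier) (j : ℕ), ‖(x : ℕ → E) j‖ ≤ (obj E).nrm x
  norm_single : ∀ (x : (obj 𝕜).carrier) (j : ℕ),
    (x : ℕ → 𝕜) = Pi.single j 1 → (obj 𝕜).nrm x = 1

/-- A scalar sequence space: a Banach space `L` of scalar sequences that contains `c₀₀`, is
contained in `ℓ_∞` with `‖x‖_∞ ≤ ‖x‖_L`, and in which the sequence of unit vectors `e_j` is a
Schauder basis and consists of vectors of norm one. -/
structure ScalarSequenceSpace (𝕜 : Type u) [RCLike 𝕜] where
  space : BanachSubspace 𝕜 (ℕ → 𝕜)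
  finite_mem : ∀ x : ℕ → 𝕜, (Function.support x).Finite → x ∈ space.carrier
  norm_le : ∀ (x : space.carrier) (j : ℕ), ‖(x : ℕ → 𝕜) j‖ ≤ space.nrm x
  exists_basis : ∃ b : SchauderBasis 𝕜 space.Space,
    ∀ j : ℕ, space.incl (b j) = Pi.single j 1
  norm_single : ∀ (x : space.carrier) (j : ℕ), (x : ℕ → 𝕜) = Pi.single j 1 → space.nrm x = 1

/-- The unit vector `e_j` of a scalar sequence space. -/
def ScalarSequenceSpace.unitVector {𝕜 : Type u} [RCLike 𝕜] (L : ScalarSequenceSpace 𝕜) (j : ℕ) :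
    L.space.Space :=
  (⟨Pi.single j 1, L.finite_mem _
    ((Set.finite_singleton j).subset Pi.support_single_subset)⟩ : L.space.carrier)

/-- A Banach operator ideal over `𝕜`: each component `I(E, F)` is a linear subspace of the space of
bounded operators, complete in a norm `‖·‖_I` of its own; `id_𝕜` belongs to the ideal with norm one;
and `w ∘ v ∘ u` belongs to it, with `‖w ∘ v ∘ u‖_I ≤ ‖w‖ ‖v‖_I ‖u‖`, whenever `v` does and `u`, `w`
are bounded. -/
structure BanachOperatorIdeal (𝕜 : Type u) [RCLike 𝕜] where
  comp : ∀ (E F : Type u) [NormedAddCommGroup E] [NormedSpace 𝕜 E] [CompleteSpace E]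
    [NormedAddCommGroup F] [NormedSpace 𝕜 F] [CompleteSpace F], BanachSubspace 𝕜 (E →L[𝕜] F)
  id_mem : ContinuousLinearMap.id 𝕜 𝕜 ∈ (comp 𝕜 𝕜).carrier
  norm_id : (comp 𝕜 𝕜).nrm ⟨ContinuousLinearMap.id 𝕜 𝕜, id_mem⟩ = 1
  ideal_mem : ∀ {E F G H : Type u} [NormedAddCommGroup E] [NormedSpace 𝕜 E] [CompleteSpace E]
    [NormedAddCommGroup F] [NormedSpace 𝕜 F] [CompleteSpace F]
    [NormedAddCommGroup G] [NormedSpace 𝕜 G] [CompleteSpace G]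
    [NormedAddCommGroup H] [NormedSpace 𝕜 H] [CompleteSpace H]
    (u : E →L[𝕜] F) (v : F →L[𝕜] G) (w : G →L[𝕜] H),
    v ∈ (comp F G).carrier → w.comp (v.comp u) ∈ (comp E H).carrier
  ideal_norm_le : ∀ {E F G H : Type u} [NormedAddCommGroup E] [NormedSpace 𝕜 E] [CompleteSpace E]
    [NormedAddCommGroup F] [NormedSpace 𝕜 F] [CompleteSpace F]
    [NormedAddCommGroup G] [NormedSpace 𝕜 G] [CompleteSpace G]
    [NormedAddCommGroup H] [NormedSpace 𝕜 H] [CompleteSpace H]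
    (u : E →L[𝕜] F) (v : F →L[𝕜] G) (w : G →L[𝕜] H) (hv : v ∈ (comp F G).carrier),
    (comp E H).nrm ⟨w.comp (v.comp u), ideal_mem u v w hv⟩ ≤
      ‖w‖ * (comp F G).nrm ⟨v, hv⟩ * ‖u‖

/-- `X` is represented by the ideal `I` and the scalar sequence space `L`: for every Banach space
`E`, the map `u ↦ (u(e_j))_j` is a well defined isometric isomorphism from `I(L, E)` onto `X(E)`. -/
def SequenceClass.IsRepresentedBy {𝕜 : Type u} [RCLike 𝕜] (X : SequenceClass 𝕜)
    (I : BanachOperatorIdeal 𝕜) (L : ScalarSequenceSpace 𝕜) : Prop :=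
  ∀ (E : Type u) [NormedAddCommGroup E] [NormedSpace 𝕜 E] [CompleteSpace E],
    ∃ Ψ : (I.comp L.space.Space E).Space ≃ₗᵢ[𝕜] (X.obj E).Space,
      ∀ (v : (I.comp L.space.Space E).Space) (j : ℕ),
        (X.obj E).incl (Ψ v) j = (I.comp L.space.Space E).incl v (L.unitVector j)

/-- A sequence class is ideal-representable if it is represented by some Banach operator ideal and
some scalar sequence space. -/
def SequenceClass.IsIdealRepresentable {𝕜 : Type u} [RCLike 𝕜] (X : SequenceClass 𝕜) : Prop :=
  ∃ (I : BanachOperatorIdeal 𝕜) (L : ScalarSequenceSpace 𝕜), X.IsRepresentedBy I L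

/-- The Rademacher functions `t ↦ sign (sin (2ⁿ π t))`, `n = 1, 2, …`, indexed here from `0`. -/
def rademacher (j : ℕ) (t : ℝ) : ℝ := Real.sign (Real.sin (2 ^ (j + 1) * Real.pi * t))

/-- Lebesgue measure on `[0, 1]`. -/
def unitMeasure : Measure ℝ := volume.restrict (Set.Icc 0 1)

section RademacherSums

variable (𝕜 : Type*) [RCLike 𝕜] {E : Type*} [NormedAddCommGroup E] [NormedSpace 𝕜 E]

/-- The partial sum `∑_{j < n} r_j(t) x_j`. -/
def radPartial (x : ℕ → E) (n : ℕ) (t : ℝ) : E :=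
  ∑ j ∈ Finset.range n, ((rademacher j t : ℝ) : 𝕜) • x j

instance : IsProbabilityMeasure unitMeasure := ⟨by simp [unitMeasure]⟩

theorem measurable_rademacher (j : ℕ) : Measurable (rademacher j) := by
  have h : Measurable Real.sign := by
    unfold Real.sign
    exact Measurable.ite measurableSet_Iio measurable_const
      (Measurable.ite measurableSet_Ioi measurable_const measurable_const)
  exact h.comp (by fun_prop)

theorem abs_rademacher_le (j : ℕ) (t : ℝ) : |rademacher j t| ≤ 1 := by
  unfold rademacher
  rcases Real.sign_apply_eq (Real.sin (2 ^ (j + 1) * Real.pi * t)) with h | h | h <;> simp [h]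

theorem stronglyMeasurable_radPartial (x : ℕ → E) (n : ℕ) :
    StronglyMeasurable (radPartial 𝕜 x n) := by
  unfold radPartial
  refine Finset.stronglyMeasurable_fun_sum _ fun j _ => ?_
  have h : Measurable fun t => ((rademacher j t : ℝ) : 𝕜) :=
    RCLike.measurable_ofReal.comp (measurable_rademacher j)
  exact h.stronglyMeasurable.smul_const (x j)

theorem norm_radPartial_le (x : ℕ → E) (n : ℕ) (t : ℝ) :
    ‖radPartial 𝕜 x n t‖ ≤ ∑ j ∈ Finset.range n, ‖x j‖ := by
  refine norm_sum_le_of_le _ fun j _ => ?_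
  rw [norm_smul, RCLike.norm_ofReal]
  exact mul_le_of_le_one_left (norm_nonneg _) (abs_rademacher_le j t)

theorem memLp_radPartial (x : ℕ → E) (n : ℕ) : MemLp (radPartial 𝕜 x n) 2 unitMeasure :=
  MemLp.of_bound (stronglyMeasurable_radPartial 𝕜 x n).aestronglyMeasurable _
    (Eventually.of_forall (norm_radPartial_le 𝕜 x n))

/-- The partial sum `∑_{j < n} r_j x_j` as an element of `L₂([0, 1]; E)`. -/
def radPartialLp (x : ℕ → E) (n : ℕ) : Lp E 2 unitMeasure :=
  (memLp_radPartial 𝕜 x n).toLp (radPartial 𝕜 x n)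

/-- The sum `∑_j r_j x_j`, the limit of the partial sums in `L₂([0, 1]; E)`. -/
def radSum (x : ℕ → E) : Lp E 2 unitMeasure := limUnder atTop (radPartialLp 𝕜 x)

/-- The series `∑_j r_j x_j` converges in `L₂([0, 1]; E)`. -/
def IsRadSummable (x : ℕ → E) : Prop :=
  ∃ f : Lp E 2 unitMeasure, Tendsto (radPartialLp 𝕜 x) atTop (𝓝 f)

variable {𝕜}

theorem IsRadSummable.tendsto {x : ℕ → E} (h : IsRadSummable 𝕜 x) :
    Tendsto (radPartialLp 𝕜 x) atTop (𝓝 (radSum 𝕜 x)) :=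
  tendsto_nhds_limUnder h

theorem radPartialLp_add (x y : ℕ → E) (n : ℕ) :
    radPartialLp 𝕜 (x + y) n = radPartialLp 𝕜 x n + radPartialLp 𝕜 y n := by
  unfold radPartialLp
  rw [← MemLp.toLp_add]
  congr 1
  funext t
  simp [radPartial, Finset.sum_add_distrib]

theorem radPartialLp_smul (c : 𝕜) (x : ℕ → E) (n : ℕ) :
    radPartialLp 𝕜 (c • x) n = c • radPartialLp 𝕜 x n := by
  unfold radPartialLp
  rw [← MemLp.toLp_const_smul]
  congr 1
  funext t
  simp [radPartial, Finset.smul_sum, smul_comm c]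

theorem IsRadSummable.add {x y : ℕ → E} (hx : IsRadSummable 𝕜 x) (hy : IsRadSummable 𝕜 y) :
    Tendsto (radPartialLp 𝕜 (x + y)) atTop (𝓝 (radSum 𝕜 x + radSum 𝕜 y)) := by
  simpa only [funext (radPartialLp_add (𝕜 := 𝕜) x y)] using hx.tendsto.add hy.tendsto

theorem IsRadSummable.smul (c : 𝕜) {x : ℕ → E} (hx : IsRadSummable 𝕜 x) :
    Tendsto (radPartialLp 𝕜 (c • x)) atTop (𝓝 (c • radSum 𝕜 x)) := by
  simpa only [funext (radPartialLp_smul (𝕜 := 𝕜) c x)] using hx.tendsto.const_smul c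

theorem tendsto_radPartialLp_of_finite {x : ℕ → E} {N : ℕ} (h : ∀ j ≥ N, x j = 0) :
    Tendsto (radPartialLp 𝕜 x) atTop (𝓝 (radPartialLp 𝕜 x N)) := by
  refine tendsto_atTop_of_eventually_const (i₀ := N) fun n hn => ?_
  unfold radPartialLp
  congr 1
  funext t
  unfold radPartial
  refine (Finset.sum_subset (Finset.range_mono hn) fun j _ hj => ?_).symm
  rw [h j (by simpa using hj), smul_zero]

/-- The vector space of almost unconditionally summable sequences. -/
def radSubmodule (𝕜 : Type*) [RCLike 𝕜] (E : Type*) [NormedAddCommGroup E] [NormedSpace 𝕜 E] :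
    Submodule 𝕜 (ℕ → E) where
  carrier := {x | IsRadSummable 𝕜 x}
  add_mem' hx hy := ⟨_, hx.add hy⟩
  zero_mem' := ⟨_, tendsto_radPartialLp_of_finite (N := 0) fun _ _ => rfl⟩
  smul_mem' c _ hx := ⟨_, hx.smul c⟩

/-- The norm `‖∑_j r_j x_j‖` of `L₂([0, 1]; E)`. -/
def radSeminorm (𝕜 : Type*) [RCLike 𝕜] (E : Type*) [NormedAddCommGroup E] [NormedSpace 𝕜 E] :
    Seminorm 𝕜 (radSubmodule 𝕜 E) :=
  Seminorm.of (fun x => ‖radSum 𝕜 (x : ℕ → E)‖)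
    (fun x y => by
      have h : radSum 𝕜 ((x + y : radSubmodule 𝕜 E) : ℕ → E) = radSum 𝕜 x + radSum 𝕜 y :=
        (IsRadSummable.add x.2 y.2).limUnder_eq
      simpa only [h] using norm_add_le (radSum 𝕜 (x : ℕ → E)) (radSum 𝕜 (y : ℕ → E)))
    (fun c x => by
      have h : radSum 𝕜 ((c • x : radSubmodule 𝕜 E) : ℕ → E) = c • radSum 𝕜 x :=
        (IsRadSummable.smul c x.2).limUnder_eq
      simp only [h, norm_smul])

/-- An auxiliary quantity: `∫₀¹ ‖a + ∑_{j < n} r_j x_j‖²`. -/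
def radInt (𝕜 : Type*) [RCLike 𝕜] {E : Type*} [NormedAddCommGroup E] [NormedSpace 𝕜 E]
    (a : E) (x : ℕ → E) (n : ℕ) : ℝ :=
  ∫ t in (0 : ℝ)..1, ‖a + radPartial 𝕜 x n t‖ ^ 2

theorem rademacher_zero_left {t : ℝ} (h0 : 0 < t) (h1 : t < 1 / 2) : rademacher 0 t = 1 := by
  refine Real.sign_of_pos (Real.sin_pos_of_pos_of_lt_pi ?_ ?_)
  · have := Real.pi_pos
    positivity
  · have := Real.pi_pos
    norm_num
    nlinarith

theorem rademacher_zero_right {t : ℝ} (h0 : 1 / 2 < t) (h1 : t < 1) : rademacher 0 t = -1 := by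
  refine Real.sign_of_neg ?_
  have hpi := Real.pi_pos
  have h : Real.sin (2 ^ (0 + 1) * Real.pi * t - 2 * Real.pi) < 0 :=
    Real.sin_neg_of_neg_of_neg_pi_lt (by norm_num; nlinarith) (by norm_num; nlinarith)
  rwa [Real.sin_sub_two_pi] at h

theorem rademacher_succ (j : ℕ) (t : ℝ) : rademacher (j + 1) t = rademacher j (2 * t) := by
  unfold rademacher
  congr 2
  ring

theorem rademacher_add_one (j : ℕ) (t : ℝ) : rademacher j (t + 1) = rademacher j t := by
  unfold rademacher
  have h : (2 : ℝ) ^ (j + 1) * Real.pi * (t + 1) =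
      2 ^ (j + 1) * Real.pi * t + ((2 ^ j : ℕ) : ℝ) * (2 * Real.pi) := by
    push_cast
    ring
  rw [h, Real.sin_add_nat_mul_two_pi]

theorem radPartial_succ (x : ℕ → E) (n : ℕ) (t : ℝ) :
    radPartial 𝕜 x (n + 1) t =
      ((rademacher 0 t : ℝ) : 𝕜) • x 0 + radPartial 𝕜 (fun j => x (j + 1)) n (2 * t) := by
  unfold radPartial
  rw [Finset.sum_range_succ', add_comm]
  simp only [rademacher_succ]

theorem radPartial_add_one (x : ℕ → E) (n : ℕ) (t : ℝ) :
    radPartial 𝕜 x n (t + 1) = radPartial 𝕜 x n t := by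
  simp only [radPartial, rademacher_add_one]

theorem intervalIntegrable_radInt (a : E) (x : ℕ → E) (n : ℕ) (c d : ℝ) :
    IntervalIntegrable (fun t => ‖a + radPartial 𝕜 x n t‖ ^ 2) volume c d := by
  refine (intervalIntegrable_const (c := (‖a‖ + ∑ j ∈ Finset.range n, ‖x j‖) ^ 2)).mono_fun
    ?_ (Eventually.of_forall fun t => ?_)
  · exact ((stronglyMeasurable_const.add
      (stronglyMeasurable_radPartial 𝕜 x n)).norm.pow 2).aestronglyMeasurable
  · change ‖‖a + radPartial 𝕜 x n t‖ ^ 2‖ ≤ ‖(‖a‖ + ∑ j ∈ Finset.range n, ‖x j‖) ^ 2‖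
    rw [Real.norm_of_nonneg (by positivity), Real.norm_of_nonneg (by positivity)]
    gcongr
    exact (norm_add_le _ _).trans (add_le_add le_rfl (norm_radPartial_le 𝕜 x n t))

theorem radInt_zero (a : E) (x : ℕ → E) : radInt 𝕜 a x 0 = ‖a‖ ^ 2 := by
  simp [radInt, radPartial]

theorem radInt_succ (a : E) (x : ℕ → E) (n : ℕ) :
    radInt 𝕜 a x (n + 1) =
      (radInt 𝕜 (a + x 0) (fun j => x (j + 1)) n +
        radInt 𝕜 (a - x 0) (fun j => x (j + 1)) n) / 2 := by
  have hl : ∫ t in (0 : ℝ)..(1 / 2), ‖a + radPartial 𝕜 x (n + 1) t‖ ^ 2 =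
      radInt 𝕜 (a + x 0) (fun j => x (j + 1)) n / 2 := by
    have h1 : ∫ t in (0 : ℝ)..(1 / 2), ‖a + radPartial 𝕜 x (n + 1) t‖ ^ 2 =
        ∫ t in (0 : ℝ)..(1 / 2),
          (fun s => ‖(a + x 0) + radPartial 𝕜 (fun j => x (j + 1)) n s‖ ^ 2) (2 * t) := by
      refine intervalIntegral.integral_congr_Ioo_of_le (by norm_num) fun t ht => ?_
      simp only [radPartial_succ, rademacher_zero_left ht.1 ht.2]
      simp [add_assoc]
    rw [h1, intervalIntegral.integral_comp_mul_left
      (fun s => ‖(a + x 0) + radPartial 𝕜 (fun j => x (j + 1)) n s‖ ^ 2)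
      (by norm_num : (2 : ℝ) ≠ 0)]
    norm_num [radInt]
    ring
  have hr : ∫ t in (1 / 2 : ℝ)..1, ‖a + radPartial 𝕜 x (n + 1) t‖ ^ 2 =
      radInt 𝕜 (a - x 0) (fun j => x (j + 1)) n / 2 := by
    have h1 : ∫ t in (1 / 2 : ℝ)..1, ‖a + radPartial 𝕜 x (n + 1) t‖ ^ 2 =
        ∫ t in (1 / 2 : ℝ)..1,
          (fun s => ‖(a - x 0) + radPartial 𝕜 (fun j => x (j + 1)) n s‖ ^ 2) (2 * t) := by
      refine intervalIntegral.integral_congr_Ioo_of_le (by norm_num) fun t ht => ?_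
      simp only [radPartial_succ, rademacher_zero_right ht.1 ht.2]
      simp [add_assoc, sub_eq_add_neg]
    have hper : Function.Periodic
        (fun s => ‖(a - x 0) + radPartial 𝕜 (fun j => x (j + 1)) n s‖ ^ 2) 1 := fun s => by
      simp only [radPartial_add_one]
    have h2 := hper.intervalIntegral_add_eq 1 0
    rw [h1, intervalIntegral.integral_comp_mul_left
      (fun s => ‖(a - x 0) + radPartial 𝕜 (fun j => x (j + 1)) n s‖ ^ 2)
      (by norm_num : (2 : ℝ) ≠ 0)]
    norm_num at h2 ⊢
    rw [h2, radInt]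
    ring
  rw [radInt, ← intervalIntegral.integral_add_adjacent_intervals
    (intervalIntegrable_radInt a x (n + 1) 0 (1 / 2))
    (intervalIntegrable_radInt a x (n + 1) (1 / 2) 1), hl, hr]
  ring

theorem radInt_le_succ (n : ℕ) : ∀ (a : E) (x : ℕ → E),
    radInt 𝕜 a x n ≤ radInt 𝕜 a x (n + 1) := by
  induction n with
  | zero =>
    intro a x
    rw [radInt_succ, radInt_zero, radInt_zero, radInt_zero]
    have h : 2 * ‖a‖ ≤ ‖a + x 0‖ + ‖a - x 0‖ := by
      have h2 := norm_add_le (a + x 0) (a - x 0)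
      rw [show (a + x 0) + (a - x 0) = (2 : 𝕜) • a by rw [two_smul]; abel, norm_smul] at h2
      simpa using h2
    nlinarith [sq_nonneg (‖a + x 0‖ - ‖a - x 0‖), norm_nonneg a,
      norm_nonneg (a + x 0), norm_nonneg (a - x 0)]
  | succ n ih =>
    intro a x
    rw [radInt_succ, radInt_succ a x (n + 1)]
    have h1 := ih (a + x 0) (fun j => x (j + 1))
    have h2 := ih (a - x 0) (fun j => x (j + 1))
    linarith

theorem radInt_mono (a : E) (x : ℕ → E) : Monotone (radInt 𝕜 a x) :=
  monotone_nat_of_le_succ fun n => radInt_le_succ n a x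

theorem sq_norm_le_radInt (n : ℕ) : ∀ (a : E) (x : ℕ → E) (k : ℕ), k < n →
    ‖x k‖ ^ 2 ≤ radInt 𝕜 a x n := by
  induction n with
  | zero => intro a x k hk; omega
  | succ n ih =>
    intro a x k hk
    rw [radInt_succ]
    cases k with
    | zero =>
      have h1 := radInt_mono (𝕜 := 𝕜) (a + x 0) (fun j => x (j + 1)) (Nat.zero_le n)
      have h2 := radInt_mono (𝕜 := 𝕜) (a - x 0) (fun j => x (j + 1)) (Nat.zero_le n)
      rw [radInt_zero] at h1 h2
      have h : 2 * ‖x 0‖ ≤ ‖a + x 0‖ + ‖a - x 0‖ := by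
        have h3 := norm_sub_le (a + x 0) (a - x 0)
        rw [show (a + x 0) - (a - x 0) = (2 : 𝕜) • x 0 by rw [two_smul]; abel, norm_smul] at h3
        simpa using h3
      nlinarith [sq_nonneg (‖a + x 0‖ - ‖a - x 0‖), norm_nonneg (x 0),
        norm_nonneg (a + x 0), norm_nonneg (a - x 0)]
    | succ k =>
      have h1 := ih (a + x 0) (fun j => x (j + 1)) k (by omega)
      have h2 := ih (a - x 0) (fun j => x (j + 1)) k (by omega)
      linarith

theorem sq_norm_radPartialLp (x : ℕ → E) (n : ℕ) :
    ‖radPartialLp 𝕜 x n‖ ^ 2 = radInt 𝕜 0 x n := by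
  have h := memLp_radPartial 𝕜 x n
  have hint : ∫ t, ‖radPartial 𝕜 x n t‖ ^ 2 ∂unitMeasure = radInt 𝕜 0 x n := by
    rw [radInt, intervalIntegral.integral_of_le zero_le_one, ← integral_Icc_eq_integral_Ioc]
    simp [unitMeasure]
  have hnn : 0 ≤ ∫ t, ‖radPartial 𝕜 x n t‖ ^ 2 ∂unitMeasure :=
    integral_nonneg fun t => by positivity
  rw [radPartialLp, Lp.norm_toLp,
    h.eLpNorm_eq_integral_rpow_norm two_ne_zero ENNReal.ofNat_ne_top, ← hint]
  simp only [ENNReal.toReal_ofNat, Real.rpow_two]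
  rw [ENNReal.toReal_ofReal (by positivity), ← Real.rpow_natCast, ← Real.rpow_mul hnn]
  norm_num

theorem norm_radPartialLp_mono (x : ℕ → E) : Monotone fun n => ‖radPartialLp 𝕜 x n‖ := by
  intro m n hmn
  refine le_of_sq_le_sq ?_ (norm_nonneg _)
  rw [sq_norm_radPartialLp, sq_norm_radPartialLp]
  exact radInt_mono 0 x hmn

theorem IsRadSummable.norm_partial_le {x : ℕ → E} (h : IsRadSummable 𝕜 x) (n : ℕ) :
    ‖radPartialLp 𝕜 x n‖ ≤ ‖radSum 𝕜 x‖ :=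
  (norm_radPartialLp_mono x).ge_of_tendsto h.tendsto.norm n

theorem IsRadSummable.norm_le {x : ℕ → E} (h : IsRadSummable 𝕜 x) (k : ℕ) :
    ‖x k‖ ≤ ‖radSum 𝕜 x‖ := by
  refine le_trans (le_of_sq_le_sq ?_ (norm_nonneg _)) (h.norm_partial_le (k + 1))
  rw [sq_norm_radPartialLp]
  exact sq_norm_le_radInt (k + 1) 0 x k (Nat.lt_succ_self k)

theorem radPartialLp_sub (x y : ℕ → E) (n : ℕ) :
    radPartialLp 𝕜 (x - y) n = radPartialLp 𝕜 x n - radPartialLp 𝕜 y n := by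
  have h := radPartialLp_add (𝕜 := 𝕜) x ((-1 : 𝕜) • y) n
  rw [radPartialLp_smul] at h
  simpa only [neg_one_smul, ← sub_eq_add_neg] using h

theorem IsRadSummable.radSum_sub {x y : ℕ → E} (hx : IsRadSummable 𝕜 x)
    (hy : IsRadSummable 𝕜 y) : radSum 𝕜 (x - y) = radSum 𝕜 x - radSum 𝕜 y := by
  refine Tendsto.limUnder_eq ?_
  simpa only [← funext (radPartialLp_sub (𝕜 := 𝕜) x y)] using hx.tendsto.sub hy.tendsto

theorem norm_radPartialLp_le (x : ℕ → E) (n : ℕ) :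
    ‖radPartialLp 𝕜 x n‖ ≤ ∑ j ∈ Finset.range n, ‖x j‖ := by
  have h := Lp.norm_le_of_ae_bound (f := radPartialLp 𝕜 x n)
    (C := ∑ j ∈ Finset.range n, ‖x j‖) (by positivity) (by
      filter_upwards [(memLp_radPartial 𝕜 x n).coeFn_toLp] with t ht
      rw [radPartialLp, ht]
      exact norm_radPartial_le 𝕜 x n t)
  have h1 : measureUnivNNReal unitMeasure = 1 := by simp [measureUnivNNReal]
  simpa [h1] using h

theorem tendsto_radPartialLp_of_pointwise {s : ℕ → ℕ → E} {x : ℕ → E}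
    (h : ∀ j, Tendsto (fun m => s m j) atTop (𝓝 (x j))) (n : ℕ) :
    Tendsto (fun m => radPartialLp 𝕜 (s m) n) atTop (𝓝 (radPartialLp 𝕜 x n)) := by
  rw [tendsto_iff_norm_sub_tendsto_zero]
  have h0 : Tendsto (fun m => ∑ j ∈ Finset.range n, ‖s m j - x j‖) atTop (𝓝 0) := by
    have h1 := tendsto_finsetSum (Finset.range n) fun j _ =>
      tendsto_iff_norm_sub_tendsto_zero.1 (h j)
    simpa using h1
  refine squeeze_zero (fun _ => norm_nonneg _) (fun m => ?_) h0
  rw [← radPartialLp_sub]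
  exact norm_radPartialLp_le (s m - x) n

theorem rad_complete [CompleteSpace E] (s : ℕ → radSubmodule 𝕜 E)
    (hs : ∀ ε : ℝ, 0 < ε → ∃ N : ℕ, ∀ m ≥ N, ∀ n ≥ N, radSeminorm 𝕜 E (s m - s n) < ε) :
    ∃ x : radSubmodule 𝕜 E, Tendsto (fun n => radSeminorm 𝕜 E (s n - x)) atTop (𝓝 0) := by
  have hsub : ∀ y z : radSubmodule 𝕜 E,
      radSeminorm 𝕜 E (y - z) = ‖radSum 𝕜 (y : ℕ → E) - radSum 𝕜 (z : ℕ → E)‖ := fun y z => by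
    rw [← IsRadSummable.radSum_sub y.2 z.2]
    rfl
  have hcau : CauchySeq fun m => radSum 𝕜 (s m : ℕ → E) := by
    rw [Metric.cauchySeq_iff]
    intro ε hε
    obtain ⟨N, hN⟩ := hs ε hε
    refine ⟨N, fun m hm n hn => ?_⟩
    rw [dist_eq_norm, ← hsub]
    exact hN m hm n hn
  obtain ⟨f, hf⟩ := cauchySeq_tendsto_of_complete hcau
  have hpt : ∀ j, ∃ y : E, Tendsto (fun m => (s m : ℕ → E) j) atTop (𝓝 y) := fun j => by
    refine cauchySeq_tendsto_of_complete ?_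
    rw [Metric.cauchySeq_iff]
    intro ε hε
    obtain ⟨N, hN⟩ := hs ε hε
    refine ⟨N, fun m hm n hn => ?_⟩
    rw [dist_eq_norm]
    exact lt_of_le_of_lt (IsRadSummable.norm_le (s m - s n).2 j) (hN m hm n hn)
  choose x hx using hpt
  have hbound : ∀ m n, ‖radPartialLp 𝕜 x n - radPartialLp 𝕜 (s m : ℕ → E) n‖ ≤
      ‖f - radSum 𝕜 (s m : ℕ → E)‖ := fun m n => by
    refine le_of_tendsto_of_tendsto'
      ((tendsto_radPartialLp_of_pointwise hx n).sub_const _).norm (hf.sub_const _).norm fun k => ?_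
    rw [← radPartialLp_sub, ← IsRadSummable.radSum_sub (s k).2 (s m).2]
    exact IsRadSummable.norm_partial_le (s k - s m).2 n
  have hlim : Tendsto (radPartialLp 𝕜 x) atTop (𝓝 f) := by
    rw [Metric.tendsto_atTop]
    intro ε hε
    obtain ⟨M, hM⟩ := Metric.tendsto_atTop.1 hf (ε / 3) (by positivity)
    obtain ⟨N, hN⟩ := Metric.tendsto_atTop.1 (IsRadSummable.tendsto (s M).2) (ε / 3) (by positivity)
    refine ⟨N, fun n hn => ?_⟩
    have h1 := hbound M n
    have h2 := hN n hn
    have h3 := hM M le_rfl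
    rw [← dist_eq_norm, ← dist_eq_norm, dist_comm f] at h1
    have h4 := dist_triangle4 (radPartialLp 𝕜 x n) (radPartialLp 𝕜 (s M : ℕ → E) n)
      (radSum 𝕜 (s M : ℕ → E)) f
    linarith
  have hxf : radSum 𝕜 x = f := hlim.limUnder_eq
  refine ⟨⟨x, f, hlim⟩, ?_⟩
  simp only [hsub, hxf]
  exact tendsto_iff_norm_sub_tendsto_zero.1 hf

theorem radSum_of_finite {x : ℕ → E} {N : ℕ} (h : ∀ j ≥ N, x j = 0) :
    radSum 𝕜 x = radPartialLp 𝕜 x N :=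
  (tendsto_radPartialLp_of_finite h).limUnder_eq

theorem isRadSummable_of_finite {x : ℕ → E} (hx : (Function.support x).Finite) :
    IsRadSummable 𝕜 x := by
  obtain ⟨N, hN⟩ := hx.bddAbove
  refine ⟨_, tendsto_radPartialLp_of_finite (N := N + 1) fun j hj => ?_⟩
  by_contra h
  have := hN (Function.mem_support.2 h)
  omega

theorem norm_radSum_single (j : ℕ) : ‖radSum 𝕜 (Pi.single j (1 : 𝕜) : ℕ → 𝕜)‖ = 1 := by
  have hle : ‖radSum 𝕜 (Pi.single j (1 : 𝕜) : ℕ → 𝕜)‖ ≤ 1 := by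
    rw [radSum_of_finite (N := j + 1) fun i hi => Pi.single_eq_of_ne (by omega) _]
    refine (norm_radPartialLp_le _ _).trans ?_
    rw [Finset.sum_eq_single j (fun i _ hij => by simp [Pi.single_eq_of_ne hij]) (by simp)]
    simp
  have hge := IsRadSummable.norm_le (𝕜 := 𝕜) (x := (Pi.single j (1 : 𝕜) : ℕ → 𝕜))
    (isRadSummable_of_finite ((Set.finite_singleton j).subset Pi.support_single_subset)) j
  simp only [Pi.single_eq_same, norm_one] at hge
  exact le_antisymm hle hge

end RademacherSums

/-- The sequence class `Rad`: `Rad(E)` is the space of almost unconditionally summable sequences in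
`E`, those for which `∑_j r_j x_j` converges in `L₂([0, 1]; E)`, where `(r_j)` is the sequence of
Rademacher functions, with the norm of `∑_j r_j x_j` in `L₂([0, 1]; E)`. -/
def Rad (𝕜 : Type u) [RCLike 𝕜] : SequenceClass 𝕜 where
  obj E _ _ _ :=
    { carrier := radSubmodule 𝕜 E
      nrm := radSeminorm 𝕜 E
      eq_zero_of_nrm := fun x hx => by
        refine Subtype.ext (funext fun j => norm_le_zero_iff.1 ?_)
        exact (IsRadSummable.norm_le x.2 j).trans (le_of_eq hx)
      complete := rad_complete }
  finite_mem _ _ _ _ _ hx := isRadSummable_of_finite hx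
  norm_le _ _ _ _ x j := IsRadSummable.norm_le x.2 j
  norm_single x j hx := by
    change ‖radSum 𝕜 (x : ℕ → 𝕜)‖ = 1
    rw [hx]
    exact norm_radSum_single j

end

/-! The obstruction is the parallelogram law. For a sequence `(a, b, 0, 0, …)` the square of the
`Rad` norm is the average of `‖a + b‖²` and `‖a - b‖²`. For scalars this is `|a|² + |b|²`, so
replacing `(a, b)` by `(a + b, a - b)` multiplies the norm by exactly `√2`.

Suppose `I` and `L` represent `Rad`. In any operator ideal the functionals carry their usual norm,
so the dual of `L` has the norm of `Rad 𝕜`. The operator `butterfly` on `L` therefore has an adjoint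
of norm at most `√2` (`sq_norm_comp_butterfly_le`), and by Hahn-Banach its own norm is at most `√2`
(`norm_butterfly_le`). The ideal property carries this scalar bound over to every Banach space `E`:
composing with `butterfly` the operator that represents `(a, b, 0, …)` yields half of the
parallelogram law in `E` (`parallelogram_le`). The plane with the maximum norm violates it. -/

/-! ### The `Rad` norm of sequences supported on two coordinates. -/

section RademacherPairs

variable {𝕜 : Type*} [RCLike 𝕜] {E : Type*} [NormedAddCommGroup E] [NormedSpace 𝕜 E]

/-- The four sign patterns are equally likely, and opposite patterns give the same norm. -/
theorem radInt_zero_two (x : ℕ → E) :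
    radInt 𝕜 0 x 2 = (‖x 0 + x 1‖ ^ 2 + ‖x 0 - x 1‖ ^ 2) / 2 := by
  have h1 : ‖-x 0 + x 1‖ = ‖x 0 - x 1‖ := by rw [← norm_neg]; congr 1; abel
  have h2 : ‖-x 0 - x 1‖ = ‖x 0 + x 1‖ := by rw [← norm_neg]; congr 1; abel
  simp only [radInt_succ, radInt_zero, zero_add, zero_sub, h1, h2]
  ring

theorem sq_norm_radPartialLp_two (x : ℕ → E) :
    ‖radPartialLp 𝕜 x 2‖ ^ 2 = (‖x 0 + x 1‖ ^ 2 + ‖x 0 - x 1‖ ^ 2) / 2 := by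
  rw [sq_norm_radPartialLp, radInt_zero_two]

theorem sq_norm_radSum_of_two {x : ℕ → E} (h : ∀ j ≥ 2, x j = 0) :
    ‖radSum 𝕜 x‖ ^ 2 = (‖x 0 + x 1‖ ^ 2 + ‖x 0 - x 1‖ ^ 2) / 2 := by
  rw [radSum_of_finite h, sq_norm_radPartialLp_two]

end RademacherPairs

/-! ### Passing between operators and sequences. -/

namespace SequenceClass.IsRepresentedBy

variable {𝕜 : Type u} [RCLike 𝕜] {X : SequenceClass 𝕜} {I : BanachOperatorIdeal 𝕜}
  {L : ScalarSequenceSpace 𝕜} {E : Type u} [NormedAddCommGroup E] [NormedSpace 𝕜 E]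
  [CompleteSpace E]

theorem exists_nrm_eq (h : X.IsRepresentedBy I L) {v : L.space.Space →L[𝕜] E}
    (hv : v ∈ (I.comp L.space.Space E).carrier) :
    ∃ hx : (fun j => v (L.unitVector j)) ∈ (X.obj E).carrier,
      (X.obj E).nrm ⟨_, hx⟩ = (I.comp L.space.Space E).nrm ⟨v, hv⟩ := by
  obtain ⟨Ψ, hΨ⟩ := h E
  let v' : (I.comp L.space.Space E).carrier := ⟨v, hv⟩
  let y : (X.obj E).carrier := Ψ v'
  have hy : (y : ℕ → E) = fun j => v (L.unitVector j) := funext fun j => hΨ v' j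
  have hmem : (fun j => v (L.unitVector j)) ∈ (X.obj E).carrier := hy ▸ y.2
  refine ⟨hmem, ?_⟩
  rw [show (⟨_, hmem⟩ : (X.obj E).carrier) = y from Subtype.ext hy.symm]
  exact Ψ.norm_map v'

theorem exists_operator (h : X.IsRepresentedBy I L) {x : ℕ → E} (hx : x ∈ (X.obj E).carrier) :
    ∃ v ∈ (I.comp L.space.Space E).carrier, ∀ j, v (L.unitVector j) = x j := by
  obtain ⟨Ψ, hΨ⟩ := h E
  let x' : (X.obj E).carrier := ⟨x, hx⟩
  let v : (I.comp L.space.Space E).carrier := Ψ.symm x'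
  refine ⟨v, v.2, fun j => (hΨ v j).symm.trans ?_⟩
  rw [show Ψ v = x' from Ψ.apply_symm_apply x']
  rfl

end SequenceClass.IsRepresentedBy

/-! ### The ideal norm of functionals. -/

namespace BanachOperatorIdeal

variable {𝕜 : Type u} [RCLike 𝕜] (I : BanachOperatorIdeal 𝕜) {E : Type u} [NormedAddCommGroup E]
  [NormedSpace 𝕜 E] [CompleteSpace E]

/-- A functional factors through the scalar identity, whose ideal norm is one. -/
theorem exists_nrm_functional_le (φ : E →L[𝕜] 𝕜) :
    ∃ h : φ ∈ (I.comp E 𝕜).carrier, (I.comp E 𝕜).nrm ⟨φ, h⟩ ≤ ‖φ‖ := by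
  refine ⟨I.ideal_mem φ _ (ContinuousLinearMap.id 𝕜 𝕜) I.id_mem, ?_⟩
  have h := I.ideal_norm_le φ _ (ContinuousLinearMap.id 𝕜 𝕜) I.id_mem
  rw [I.norm_id, ContinuousLinearMap.norm_id, one_mul, one_mul] at h
  exact h

/-- Composing `φ` with `c ↦ c • x` gives `φ x` times the scalar identity, of ideal norm `‖φ x‖`; the
ideal inequality bounds this by the ideal norm of `φ` times `‖x‖`. -/
theorem norm_functional_le (φ : E →L[𝕜] 𝕜) (h : φ ∈ (I.comp E 𝕜).carrier) :
    ‖φ‖ ≤ (I.comp E 𝕜).nrm ⟨φ, h⟩ := by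
  refine φ.opNorm_le_bound (apply_nonneg _ _) fun x => ?_
  have h1 := I.ideal_norm_le (ContinuousLinearMap.toSpanSingleton 𝕜 x) φ
    (ContinuousLinearMap.id 𝕜 𝕜) h
  have h2 : (⟨_, I.ideal_mem (ContinuousLinearMap.toSpanSingleton 𝕜 x) φ
      (ContinuousLinearMap.id 𝕜 𝕜) h⟩ : (I.comp 𝕜 𝕜).carrier) =
      φ x • ⟨ContinuousLinearMap.id 𝕜 𝕜, I.id_mem⟩ := by
    refine Subtype.ext (ContinuousLinearMap.ext fun c => ?_)
    simp [mul_comm]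
  rwa [h2, map_smul_eq_mul, I.norm_id, mul_one, ContinuousLinearMap.norm_id, one_mul,
    ContinuousLinearMap.norm_toSpanSingleton] at h1

end BanachOperatorIdeal

/-! ### Coordinate functionals and the butterfly operator. -/

namespace ScalarSequenceSpace

variable {𝕜 : Type u} [RCLike 𝕜] (L : ScalarSequenceSpace 𝕜)

/-- The `j`-th coordinate functional of a scalar sequence space. -/
noncomputable def coord (j : ℕ) : L.space.Space →L[𝕜] 𝕜 :=
  ((LinearMap.proj j).comp L.space.incl).mkContinuous 1 fun x => by
    rw [one_mul]
    exact L.norm_le x j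

theorem coord_unitVector (i j : ℕ) :
    L.coord i (L.unitVector j) = (Pi.single j 1 : ℕ → 𝕜) i := rfl

/-- The operator `x ↦ x₀ (e₀ + e₁) + x₁ (e₀ - e₁)`, a multiple of a rotation of the plane spanned
by the first two unit vectors. -/
noncomputable def butterfly : L.space.Space →L[𝕜] L.space.Space :=
  (L.coord 0).smulRight (L.unitVector 0 + L.unitVector 1) +
    (L.coord 1).smulRight (L.unitVector 0 - L.unitVector 1)

theorem butterfly_unitVector_zero :
    L.butterfly (L.unitVector 0) = L.unitVector 0 + L.unitVector 1 := by
  simp [butterfly, coord_unitVector]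

theorem butterfly_unitVector_one :
    L.butterfly (L.unitVector 1) = L.unitVector 0 - L.unitVector 1 := by
  simp [butterfly, coord_unitVector]

theorem butterfly_unitVector_of_two_le {j : ℕ} (hj : 2 ≤ j) :
    L.butterfly (L.unitVector j) = 0 := by
  have h0 : (0 : ℕ) ≠ j := by omega
  have h1 : (1 : ℕ) ≠ j := by omega
  simp [butterfly, coord_unitVector, Pi.single_eq_of_ne h0, Pi.single_eq_of_ne h1]

end ScalarSequenceSpace

/-! ### From the scalar bound to a parallelogram inequality in every Banach space. -/

namespace SequenceClass.IsRepresentedBy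

variable {𝕜 : Type u} [RCLike 𝕜] {I : BanachOperatorIdeal 𝕜} {L : ScalarSequenceSpace 𝕜}

theorem exists_norm_radSum_eq (h : (Rad 𝕜).IsRepresentedBy I L) {E : Type u}
    [NormedAddCommGroup E] [NormedSpace 𝕜 E] [CompleteSpace E] {v : L.space.Space →L[𝕜] E}
    (hv : v ∈ (I.comp L.space.Space E).carrier) :
    IsRadSummable 𝕜 (fun j => v (L.unitVector j)) ∧
      ‖radSum 𝕜 fun j => v (L.unitVector j)‖ = (I.comp L.space.Space E).nrm ⟨v, hv⟩ := by
  obtain ⟨hx, hn⟩ := h.exists_nrm_eq hv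
  exact ⟨hx, hn⟩

/-- The case `E = 𝕜` of the representation, where the ideal norm is the dual norm of `L`. -/
theorem norm_functional_eq (h : (Rad 𝕜).IsRepresentedBy I L) (φ : L.space.Space →L[𝕜] 𝕜) :
    IsRadSummable 𝕜 (fun j => φ (L.unitVector j)) ∧
      ‖radSum 𝕜 fun j => φ (L.unitVector j)‖ = ‖φ‖ := by
  obtain ⟨hφ, hle⟩ := I.exists_nrm_functional_le φ
  obtain ⟨hs, hn⟩ := h.exists_norm_radSum_eq hφ
  exact ⟨hs, hn.trans (le_antisymm hle (I.norm_functional_le φ hφ))⟩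

theorem sq_norm_comp_butterfly_le (h : (Rad 𝕜).IsRepresentedBy I L)
    (φ : L.space.Space →L[𝕜] 𝕜) : ‖φ.comp L.butterfly‖ ^ 2 ≤ 2 * ‖φ‖ ^ 2 := by
  rw [← (h.norm_functional_eq (φ.comp L.butterfly)).2, sq_norm_radSum_of_two fun j hj => by
    simp [L.butterfly_unitVector_of_two_le hj]]
  obtain ⟨hs, hn⟩ := h.norm_functional_eq φ
  -- `φ` may be nonzero on later unit vectors, but truncating after two terms does not increase the
  -- `Rad` norm.
  have h2 := pow_le_pow_left₀ (norm_nonneg _) (hs.norm_partial_le 2) 2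
  rw [hn, sq_norm_radPartialLp_two] at h2
  simp only [ContinuousLinearMap.comp_apply, L.butterfly_unitVector_zero,
    L.butterfly_unitVector_one, map_add, map_sub]
  have h3 := parallelogram_law_with_norm 𝕜 (φ (L.unitVector 0) + φ (L.unitVector 1))
    (φ (L.unitVector 0) - φ (L.unitVector 1))
  nlinarith

/-- Test each value of `butterfly` against a norming functional and use the bound on the adjoint. -/
theorem norm_butterfly_le (h : (Rad 𝕜).IsRepresentedBy I L) : ‖L.butterfly‖ ≤ √2 := by
  refine ContinuousLinearMap.opNorm_le_bound _ (Real.sqrt_nonneg _) fun x => ?_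
  obtain ⟨φ, hφ, hφx⟩ := exists_dual_vector'' 𝕜 (L.butterfly x)
  have h1 : ‖φ.comp L.butterfly‖ ≤ √2 := by
    refine Real.le_sqrt_of_sq_le ((h.sq_norm_comp_butterfly_le φ).trans ?_)
    nlinarith [norm_nonneg φ]
  have h2 : ‖φ (L.butterfly x)‖ = ‖L.butterfly x‖ := by simp [hφx]
  rw [← h2]
  exact (φ.comp L.butterfly).le_of_opNorm_le h1 x

theorem parallelogram_le (h : (Rad 𝕜).IsRepresentedBy I L) {E : Type u}
    [NormedAddCommGroup E] [NormedSpace 𝕜 E] [CompleteSpace E] (a b : E) :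
    2 * (‖a‖ ^ 2 + ‖b‖ ^ 2) ≤ ‖a + b‖ ^ 2 + ‖a - b‖ ^ 2 := by
  let x : ℕ → E := Pi.single 0 a + Pi.single 1 b
  have hx0 : x 0 = a := by simp [x]
  have hx1 : x 1 = b := by simp [x]
  have hx2 : ∀ j ≥ 2, x j = 0 := fun j hj => by
    have h0 : j ≠ 0 := by omega
    have h1 : j ≠ 1 := by omega
    simp [x, Pi.single_eq_of_ne h0, Pi.single_eq_of_ne h1]
  obtain ⟨v, hv, hvx⟩ := h.exists_operator (x := x) ⟨_, tendsto_radPartialLp_of_finite hx2⟩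
  -- `v ∘ butterfly` represents `(a + b, a - b, 0, …)`, so both ideal norms become `Rad` norms of
  -- two-term sequences.
  have hw := I.ideal_norm_le L.butterfly v (ContinuousLinearMap.id 𝕜 E) hv
  rw [← (h.exists_norm_radSum_eq _).2, ← (h.exists_norm_radSum_eq hv).2, funext hvx] at hw
  have hw2 : ‖radSum 𝕜 fun j => ((ContinuousLinearMap.id 𝕜 E).comp (v.comp L.butterfly))
      (L.unitVector j)‖ ≤ ‖radSum 𝕜 x‖ * √2 := by
    refine hw.trans (mul_le_mul ?_ h.norm_butterfly_le (norm_nonneg _) (norm_nonneg _))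
    exact mul_le_of_le_one_left (norm_nonneg _) ContinuousLinearMap.norm_id_le
  have hsq := pow_le_pow_left₀ (norm_nonneg _) hw2 2
  rw [mul_pow, Real.sq_sqrt zero_le_two, sq_norm_radSum_of_two hx2,
    sq_norm_radSum_of_two fun j hj => by simp [L.butterfly_unitVector_of_two_le hj]] at hsq
  simp only [ContinuousLinearMap.comp_apply, ContinuousLinearMap.id_apply,
    L.butterfly_unitVector_zero, L.butterfly_unitVector_one, map_add, map_sub, hvx, hx0,
    hx1] at hsq
  -- The sum and difference of `a + b` and `a - b` are `2a` and `2b`: this produces the left side of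
  -- the inequality.
  have ha : ‖a + b + (a - b)‖ = 2 * ‖a‖ := by
    rw [show a + b + (a - b) = (2 : 𝕜) • a by rw [two_smul]; abel, norm_smul]
    simp
  have hb : ‖a + b - (a - b)‖ = 2 * ‖b‖ := by
    rw [show a + b - (a - b) = (2 : 𝕜) • b by rw [two_smul]; abel, norm_smul]
    simp
  rw [ha, hb] at hsq
  linarith

end SequenceClass.IsRepresentedBy

theorem mainTheorem3 (𝕜 : Type u) [RCLike 𝕜] : ¬ (Rad 𝕜).IsIdealRepresentable := by
  rintro ⟨I, L, h⟩
  -- The product carries the maximum norm, in which `a`, `b` and `a ± b` all have norm one; the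
  -- inequality would read `4 ≤ 2`.
  have h1 := h.parallelogram_le ((1, 0) : 𝕜 × 𝕜) (0, 1)
  norm_num [Prod.norm_def] at h1
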